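/- Let $\mathscr P\subseteq\mathbb C[t,x]$ be a set of polynomials in the variables $x=(x_1,\dots,x_n)$ and the parameters $t=(t_1,\dots,t_m)$. For $a\in\mathbb C^m$ let $\mathscr P(a,x)\subseteq\mathbb C[x]$ be the system obtained by substituting $t=a$. The multiplicity of a solution $p\in\mathbb C^n$ of $\mathscr P(a,x)$ is the dimension over $\mathbb C$ of the local ring at $p$ of $\mathbb C[x]/(\mathscr P(a,x))$, and the number of solutions counted with multiplicity is the sum in $\mathbb N\cup\{\infty\}$ of the multiplicities of all solutions in $\mathbb C^n$. Let $\succ_x$ and $\succ_t$ be monomial orders on $\mathbb C[x]$ and $\mathbb C[t]$, and let $\succ$ be the block order with $x\succ t$ given by $$t^{d_1}x^{e_1}\succ t^{d_2}x^{e_2}\iff x^{e_1}\succ_x x^{e_2}\ \text{ or }\ \bigl(x^{e_1}=x^{e_2}\text{ and }t^{d_1}\succ_t t^{d_2}\bigr).$$ Let $G$ be a (finite) Gröbner basis, with respect to $\succ$, of the ideal of $\mathbb C[t,x]$ generated by $\mathscr P$. Regard the elements of $G$ as polynomials in $x$ with coefficients in $\mathbb C[t]$, and let $Z\subseteq\mathbb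 C^m$ be the union of the zero sets of the nonzero polynomials in $t$ that occur as coefficients of elements of $G$. **Theorem.** Let $\ell\in\mathbb N$, and assume: 1. there is a Zariski closed proper subset $E\subsetneq\mathbb C^m$ such that for all $a\in\mathbb C^m\setminus E$ the system $\mathscr P(a,x)$ has at least $\ell$ solutions counted with multiplicity (in particular, this holds if it has at least $\ell$ distinct solutions); 2. there is $a'\in\mathbb C^m\setminus Z$ such that $\mathscr P(a',x)$ has exactly $\ell$ solutions counted with multiplicity. Then $\mathscr P(a,x)$ has exactly $\ell$ solutions counted with multiplicity for all $a\in\mathbb C^m$ outside a set of Lebesgue measure zero. -/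

import Mathlib

open MvPolynomial MeasureTheory

/-- The common zeros in `ℂ^k` of a set of polynomials. -/
def zeroSet {k : ℕ} (S : Set (MvPolynomial (Fin k) ℂ)) : Set (Fin k → ℂ) :=
  {p | ∀ f ∈ S, eval p f = 0}

/-- Zariski closed subsets of `ℂ^k`. -/
def IsZariskiClosed {k : ℕ} (E : Set (Fin k → ℂ)) : Prop :=
  ∃ S : Set (MvPolynomial (Fin k) ℂ), E = zeroSet S

/-- The coordinate ring `ℂ[x] / (S)` of a polynomial system `S`. -/
abbrev CoordRing {n : ℕ} (S : Set (MvPolynomial (Fin n) ℂ)) : Type :=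
  MvPolynomial (Fin n) ℂ ⧸ Ideal.span S

theorem eval_eq_zero_of_mem_span {n : ℕ} (S : Set (MvPolynomial (Fin n) ℂ))
    (p : zeroSet S) (f : MvPolynomial (Fin n) ℂ) (hf : f ∈ Ideal.span S) :
    aeval (R := ℂ) p.1 f = 0 := by
  have h : Ideal.span S ≤ RingHom.ker (aeval (R := ℂ) p.1) :=
    Ideal.span_le.2 fun g hg => by
      simpa [RingHom.mem_ker, aeval_eq_eval] using p.2 g hg
  exact h hf

/-- Evaluation of elements of the coordinate ring at a solution of the system. -/
noncomputable def evalAt {n : ℕ} (S : Set (MvPolynomial (Fin n) ℂ)) (p : zeroSet S) :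
    CoordRing S →ₐ[ℂ] ℂ :=
  Ideal.Quotient.liftₐ (Ideal.span S) (aeval (R := ℂ) p.1) (eval_eq_zero_of_mem_span S p)

/-- The maximal ideal of the coordinate ring that belongs to a solution of the system. -/
noncomputable def pointIdeal {n : ℕ} (S : Set (MvPolynomial (Fin n) ℂ)) (p : zeroSet S) :
    Ideal (CoordRing S) :=
  RingHom.ker (evalAt S p)

instance {n : ℕ} (S : Set (MvPolynomial (Fin n) ℂ)) (p : zeroSet S) :
    (pointIdeal S p).IsPrime :=
  RingHom.ker_isPrime (evalAt S p)

/-- The multiplicity of a solution `p` of the system `S`: the dimension over `ℂ` of the local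
ring at `p` of `ℂ[x] / (S)`. It is `⊤` when `p` is not an isolated solution. -/
noncomputable def solutionMultiplicity {n : ℕ} (S : Set (MvPolynomial (Fin n) ℂ))
    (p : zeroSet S) : ℕ∞ :=
  Cardinal.toENat (Module.rank ℂ (Localization.AtPrime (pointIdeal S p)))

/-- The number of solutions in `ℂ^n` of the system `S`, counted with multiplicity: the (possibly
infinite) sum of the multiplicities of all solutions, as the supremum of its finite partial
sums. -/
noncomputable def solutionCount {n : ℕ} (S : Set (MvPolynomial (Fin n) ℂ)) : ℕ∞ :=
  ⨆ F : Finset (zeroSet S), ∑ p ∈ F, solutionMultiplicity S p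

/-- Polynomials in the variables `x = (x_1, …, x_n)` (left summand) and the parameters
`t = (t_1, …, t_m)` (right summand). -/
abbrev ParamPoly (n m : ℕ) : Type := MvPolynomial (Fin n ⊕ Fin m) ℂ

/-- Substitution of `a` for the parameters: `t ↦ a`, `x ↦ x`. -/
noncomputable def specialize {n m : ℕ} (a : Fin m → ℂ) :
    ParamPoly n m →ₐ[ℂ] MvPolynomial (Fin n) ℂ :=
  aeval (Sum.elim X fun j => C (a j))

/-- The system `P(a, x)`. -/
noncomputable def systemAt {n m : ℕ} (P : Set (ParamPoly n m)) (a : Fin m → ℂ) :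
    Set (MvPolynomial (Fin n) ℂ) :=
  specialize a '' P

/-- The block order with `x ≻ t` given by a monomial order in `x` and a monomial order in `t`:
compare the `x`-parts of the exponents first, and the `t`-parts in case of equality. -/
noncomputable def blockOrder {n m : ℕ} (ox : MonomialOrder (Fin n)) (ot : MonomialOrder (Fin m)) :
    MonomialOrder (Fin n ⊕ Fin m) where
  syn := Lex (ox.syn × ot.syn)
  toSyn :=
    (Finsupp.sumFinsuppAddEquivProdFinsupp.trans (AddEquiv.prodCongr ox.toSyn ot.toSyn)).trans
      (toLexAddEquiv (ox.syn × ot.syn))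
  toSyn_monotone := by
    intro a b h
    refine Prod.Lex.toLex_mono (Prod.mk_le_mk.2 ⟨ox.toSyn_monotone ?_, ot.toSyn_monotone ?_⟩)
    · exact fun i => h (Sum.inl i)
    · exact fun j => h (Sum.inr j)

theorem blockOrder_lt_iff {n m : ℕ} (ox : MonomialOrder (Fin n)) (ot : MonomialOrder (Fin m))
    (e₁ e₂ : Fin n →₀ ℕ) (d₁ d₂ : Fin m →₀ ℕ) :
    (blockOrder ox ot).toSyn (Finsupp.sumElim e₂ d₂) <
        (blockOrder ox ot).toSyn (Finsupp.sumElim e₁ d₁) ↔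
      ox.toSyn e₂ < ox.toSyn e₁ ∨ (e₁ = e₂ ∧ ot.toSyn d₂ < ot.toSyn d₁) := by
  have h : ∀ (e : Fin n →₀ ℕ) (d : Fin m →₀ ℕ),
      Finsupp.sumFinsuppAddEquivProdFinsupp (Finsupp.sumElim e d) = (e, d) := fun e d =>
    Finsupp.sumFinsuppAddEquivProdFinsupp.apply_symm_apply (e, d)
  change toLex (Prod.map ox.toSyn ot.toSyn
        (Finsupp.sumFinsuppAddEquivProdFinsupp (Finsupp.sumElim e₂ d₂))) <
      toLex (Prod.map ox.toSyn ot.toSyn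
        (Finsupp.sumFinsuppAddEquivProdFinsupp (Finsupp.sumElim e₁ d₁))) ↔ _
  rw [h, h, Prod.Lex.toLex_lt_toLex]
  simp [eq_comm]

/-- `G` is a Gröbner basis of the ideal `I`: `G` is a finite subset of `I`, and the leading terms
of `G` generate the ideal generated by all leading terms of `I`. -/
def IsGroebnerBasis {σ : Type*} (ord : MonomialOrder σ) (G : Finset (MvPolynomial σ ℂ))
    (I : Ideal (MvPolynomial σ ℂ)) : Prop :=
  (G : Set (MvPolynomial σ ℂ)) ⊆ I ∧
    Ideal.span (ord.leadingTerm '' (G : Set (MvPolynomial σ ℂ))) =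
      Ideal.span (ord.leadingTerm '' (I : Set (MvPolynomial σ ℂ)))

/-- The nonzero polynomials in `t` that occur as coefficients of elements of `G`, when these are
regarded as polynomials in `x` over `ℂ[t]`. -/
def badCoeffs {n m : ℕ} (G : Finset (ParamPoly n m)) : Set (MvPolynomial (Fin m) ℂ) :=
  {h | h ≠ 0 ∧ ∃ g ∈ G, ∃ e : Fin n →₀ ℕ, h = coeff e (sumAlgEquiv ℂ (Fin n) (Fin m) g)}

/-- The union `Z(t)` of the zero sets of the nonzero coefficients. -/
def badSet {n m : ℕ} (G : Finset (ParamPoly n m)) : Set (Fin m → ℂ) :=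
  ⋃ h ∈ badCoeffs G, {a | eval a h = 0}

/-!
Let `I` be the ideal generated by `P`, and let `a` lie outside the bad set. For every nonzero
element of `G`, regarded as a polynomial in `x` over `ℂ[t]`, the leading coefficient does not vanish
at `a`. The leading exponents in `x` of `G` then generate the leading exponents of the ideal of
`P(a, x)` (`leadingExponents_systemAt`): an element of that ideal lifts to some `h ∈ I`, and as
long as the leading coefficient of `h` vanishes at `a`, pseudo-division by an element of `G`
replaces `h` by another lift, up to a nonzero constant, with a smaller leading exponent
(`MonomialOrder.exists_degree_le_degree_map`).

Hence the standard monomials, which form a basis of the coordinate ring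
(`MonomialOrder.isCompl_restrictSupport`), are the same for all `a` outside the bad set, so that all
these coordinate rings have the same dimension. A finite number of solutions counted with
multiplicity forces the coordinate ring to be finite-dimensional, hence Artinian, and it is then the
product of its localizations at the solutions; so the number of solutions is the dimension of the
coordinate ring (`solutionCount_eq_finrank`). The value `ℓ` at `a'` is therefore attained at every
`a` outside the bad set, which is a null set, being a finite union of zero sets of nonzero
polynomials (`volume_badSet`).
-/

/-! ### Null sets of polynomial zeros -/

/-- The zero set of a nonzero polynomial is Lebesgue null: by Fubini, because for almost every
value of the other coordinates the polynomial remains nonzero in the first one, where it has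
finitely many roots. -/
theorem volume_zeros_eq_zero {m : ℕ} {p : MvPolynomial (Fin m) ℂ} (hp : p ≠ 0) :
    volume {a : Fin m → ℂ | eval a p = 0} = 0 := by
  induction m with
  | zero =>
    rw [eq_C_of_isEmpty p] at hp ⊢
    have hc : coeff 0 p ≠ 0 := fun h => hp (by rw [h, C_0])
    simp [hc]
  | succ m ih =>
    set q := finSuccEquiv ℂ m p with hq
    have hq0 : q ≠ 0 := by simpa [hq] using hp
    have hmeas : MeasurableSet
        {z : ℂ × (Fin m → ℂ) | eval (Fin.cons z.1 z.2 : Fin (m + 1) → ℂ) p = 0} := by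
      have : Continuous fun z : ℂ × (Fin m → ℂ) => (Fin.cons z.1 z.2 : Fin (m + 1) → ℂ) :=
        continuous_pi fun i => by
          refine Fin.cases ?_ (fun j => ?_) i
          · simpa using continuous_fst
          · simpa [Function.comp_def] using (continuous_apply j).comp continuous_snd
      exact (isClosed_eq ((continuous_eval p).comp this) continuous_const).measurableSet
    have hprod : (volume : Measure (ℂ × (Fin m → ℂ)))
        {z | eval (Fin.cons z.1 z.2 : Fin (m + 1) → ℂ) p = 0} = 0 := by
      rw [Measure.volume_eq_prod, Measure.prod_apply_symm hmeas,
        lintegral_eq_zero_iff (measurable_measure_prodMk_right hmeas)]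
      have hlc : ∀ᵐ s : Fin m → ℂ, eval s q.leadingCoeff ≠ 0 := by
        rw [ae_iff]
        simpa using ih (Polynomial.leadingCoeff_ne_zero.2 hq0)
      filter_upwards [hlc] with s hs
      have hmap : q.map (eval s) ≠ 0 := fun h => hs <| by
        simpa using congrArg (Polynomial.coeff · q.natDegree) h
      refine ((Polynomial.finite_setOfPred_isRoot hmap).subset fun y hy => ?_).measure_zero _
      simpa [Polynomial.IsRoot, eval_eq_eval_mv_eval'] using hy
    rw [← (volume_preserving_piFinSuccAbove (fun _ : Fin (m + 1) => ℂ) 0).measure_preimage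
      hmeas.nullMeasurableSet] at hprod
    convert hprod using 2
    ext a
    simp [MeasurableEquiv.piFinSuccAbove, Fin.insertNthEquiv, Fin.cons_self_tail, Fin.removeNth_zero]

theorem volume_badSet {n m : ℕ} (G : Finset (ParamPoly n m)) : volume (badSet G) = 0 := by
  have hsub : badCoeffs G ⊆
      ⋃ g ∈ G, ((sumAlgEquiv ℂ (Fin n) (Fin m) g).support.image
        fun e => coeff e (sumAlgEquiv ℂ (Fin n) (Fin m) g) : Finset _) := by
    rintro h ⟨h0, g, hg, e, rfl⟩
    simp only [Set.mem_iUnion, Finset.mem_coe, Finset.mem_image, mem_support_iff]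
    exact ⟨g, hg, e, h0, rfl⟩
  have hfin : (badCoeffs G).Finite :=
    (G.finite_toSet.biUnion fun g _ => Finset.finite_toSet _).subset hsub
  exact (measure_biUnion_null_iff hfin.countable).2 fun h hh => volume_zeros_eq_zero hh.1

/-! ### Leading exponents of ideals and their images -/

section LeadingExponents

variable {σ : Type*} (ord : MonomialOrder σ)

theorem MonomialOrder.eq_zero_or_degree_lt_of_coeff_eq_zero {R : Type*} [CommSemiring R]
    {f : MvPolynomial σ R} {e : σ →₀ ℕ} (hle : ord.toSyn (ord.degree f) ≤ ord.toSyn e)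
    (he : coeff e f = 0) : f = 0 ∨ ord.toSyn (ord.degree f) < ord.toSyn e := by
  refine or_iff_not_imp_left.2 fun hf => lt_of_le_of_ne hle fun h => ?_
  rw [← ord.toSyn.injective h] at he
  exact ord.coeff_degree_ne_zero_iff.2 hf he

theorem MonomialOrder.toSyn_degree_monomial_mul_le {R : Type*} [CommSemiring R]
    {B : MvPolynomial σ R} {e : σ →₀ ℕ} (hB : ord.degree B ≤ e) (c : R) :
    ord.toSyn (ord.degree (monomial (e - ord.degree B) c * B)) ≤ ord.toSyn e := by
  have h₁ : ord.toSyn (ord.degree (monomial (e - ord.degree B) c * B)) ≤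
      ord.toSyn (ord.degree (monomial (e - ord.degree B) c) + ord.degree B) := ord.degree_mul_le
  have h₂ := ord.degree_monomial_le (d := e - ord.degree B) c
  have h₃ : ord.toSyn e = ord.toSyn (e - ord.degree B) + ord.toSyn (ord.degree B) := by
    rw [← map_add, tsub_add_cancel_of_le hB]
  rw [map_add] at h₁
  rw [h₃]
  exact h₁.trans (add_le_add h₂ le_rfl)

theorem MonomialOrder.coeff_monomial_mul_of_degree_le {R : Type*} [CommSemiring R]
    {B : MvPolynomial σ R} {e : σ →₀ ℕ} (hB : ord.degree B ≤ e) (c : R) :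
    coeff e (monomial (e - ord.degree B) c * B) = c * ord.leadingCoeff B := by
  have h := coeff_monomial_mul (ord.degree B) (e - ord.degree B) c B
  rwa [tsub_add_cancel_of_le hB] at h

theorem MonomialOrder.degree_map_of_leadingCoeff_ne_zero {R K : Type*} [CommSemiring R]
    [CommSemiring K] (φ : R →+* K) {f : MvPolynomial σ R} (h : φ (ord.leadingCoeff f) ≠ 0) :
    ord.degree (map φ f) = ord.degree f := by
  refine ord.toSyn.injective (le_antisymm ?_ (ord.le_degree ?_))
  · exact ord.degree_le_iff.2 fun e he => ord.le_degree (support_map_subset φ f he)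

  · rw [mem_support_iff, coeff_map]
    exact h

/-- Let `𝓑 ⊆ J` consist of polynomials whose leading coefficients survive under a ring homomorphism
`φ` from the coefficients to a field. If the leading exponents of `𝓑` generate those of `J`, then
the same holds for the image of `J` under `φ`. If the leading coefficient of an element `H` of `J`
is killed by `φ`, pseudo-division by an element of `𝓑` lowers the leading exponent of `H` and
changes its image only by a nonzero constant factor. -/
theorem MonomialOrder.exists_degree_le_degree_map {R K : Type*} [CommRing R] [Field K]
    (φ : R →+* K) (J : Ideal (MvPolynomial σ R)) (𝓑 : Set (MvPolynomial σ R))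
    (hsub : 𝓑 ⊆ J) (hφ : ∀ B ∈ 𝓑, φ (ord.leadingCoeff B) ≠ 0)
    (hdeg : ∀ H ∈ J, H ≠ 0 → ∃ B ∈ 𝓑, ord.degree B ≤ ord.degree H)
    (H : MvPolynomial σ R) (hH : H ∈ J) (hne : map φ H ≠ 0) :
    ∃ B ∈ 𝓑, ord.degree B ≤ ord.degree (map φ H) := by
  induction hs : ord.toSyn (ord.degree H) using WellFoundedLT.induction generalizing H with
  | ind s ih =>
    have hH0 : H ≠ 0 := by rintro rfl; simp at hne
    obtain ⟨B, hB, hBH⟩ := hdeg H hH hH0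
    by_cases hlc : φ (ord.leadingCoeff H) = 0
    · set H' := C (ord.leadingCoeff B) * H -
        monomial (ord.degree H - ord.degree B) (ord.leadingCoeff H) * B with hH'
      have hmap : map φ H' = C (φ (ord.leadingCoeff B)) * map φ H := by
        simp [hH', hlc]
      have hcoeff : coeff (ord.degree H) H' = 0 := by
        rw [hH', coeff_sub, coeff_C_mul, ord.coeff_monomial_mul_of_degree_le hBH,
          ← MonomialOrder.leadingCoeff, mul_comm, sub_self]
      have hle : ord.toSyn (ord.degree H') ≤ ord.toSyn (ord.degree H) := by
        refine ord.degree_sub_le.trans (sup_le ?_ (ord.toSyn_degree_monomial_mul_le hBH _))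
        rw [← smul_eq_C_mul]
        exact ord.degree_smul_le
      have hne' : map φ H' ≠ 0 := by
        rw [hmap]
        exact mul_ne_zero (by simpa using hφ B hB) hne
      have hlt := (ord.eq_zero_or_degree_lt_of_coeff_eq_zero hle hcoeff).resolve_left
        (by rintro h; simp [h] at hne')
      have hmem : H' ∈ J := J.sub_mem (J.mul_mem_left _ hH) (J.mul_mem_left _ (hsub hB))
      obtain ⟨B', hB', hle'⟩ := ih _ (hs ▸ hlt) H' hmem hne' rfl
      refine ⟨B', hB', ?_⟩
      rwa [hmap, ord.degree_mul (by simpa using hφ B hB) hne, ord.degree_C, zero_add] at hle'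
    · refine ⟨B, hB, ?_⟩
      rwa [ord.degree_map_of_leadingCoeff_ne_zero φ hlc]

/-- Macaulay's basis theorem: the monomials that are not leading monomials of elements of `J`
span a complement of `J`. -/
theorem MonomialOrder.isCompl_restrictSupport {K : Type*} [Field K]
    (J : Ideal (MvPolynomial σ K)) :
    IsCompl (J.restrictScalars K)
      (restrictSupport K {e | ∃ f ∈ J, f ≠ 0 ∧ ord.degree f = e}ᶜ) := by
  constructor
  · rw [Submodule.disjoint_def]
    intro f hf hsupp
    by_contra h0
    exact (mem_restrictSupport_iff K).1 hsupp (ord.degree_mem_support h0) ⟨f, hf, h0, rfl⟩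
  · rw [codisjoint_iff, eq_top_iff]
    rintro f -
    induction hs : ord.toSyn (ord.degree f) using WellFoundedLT.induction generalizing f with
    | ind s ih =>
      -- Both cases remove the leading term of `f` by an element of one of the two subspaces.
      have key : ∀ g ∈ J.restrictScalars K ⊔
          restrictSupport K {e | ∃ f ∈ J, f ≠ 0 ∧ ord.degree f = e}ᶜ,
          ord.toSyn (ord.degree g) ≤ ord.toSyn (ord.degree f) →
          coeff (ord.degree f) g = ord.leadingCoeff f →
          f ∈ J.restrictScalars K ⊔
            restrictSupport K {e | ∃ f ∈ J, f ≠ 0 ∧ ord.degree f = e}ᶜ := by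
        intro g hg hle hc
        rw [← sub_add_cancel f g]
        refine Submodule.add_mem _ ?_ hg
        rcases ord.eq_zero_or_degree_lt_of_coeff_eq_zero (f := f - g) (e := ord.degree f)
          (ord.degree_sub_le.trans (sup_le le_rfl hle))
          (by rw [coeff_sub, hc]; exact sub_self _) with h | h
        · rw [h]; exact Submodule.zero_mem _
        · exact ih _ (hs ▸ h) rfl
      by_cases hf : ∃ g ∈ J, g ≠ 0 ∧ ord.degree g = ord.degree f
      · obtain ⟨g, hg, hg0, hgf⟩ := hf
        refine key (monomial (ord.degree f - ord.degree g)
            (ord.leadingCoeff f / ord.leadingCoeff g) * g)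
          (Submodule.mem_sup_left (J.mul_mem_left _ hg))
          (ord.toSyn_degree_monomial_mul_le hgf.le _) ?_
        rw [ord.coeff_monomial_mul_of_degree_le hgf.le]
        exact div_mul_cancel₀ _ (ord.leadingCoeff_ne_zero_iff.2 hg0)
      · exact key (monomial (ord.degree f) (ord.leadingCoeff f))
          (Submodule.mem_sup_right ((monomial_mem_restrictSupport K).2 (Or.inl hf)))
          (ord.degree_monomial_le _) (by classical rw [coeff_monomial, if_pos rfl])

end LeadingExponents

/-! ### Specialization of a Gröbner basis for a block order -/

section Specialization

variable {n m : ℕ}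

theorem specialize_eq_map (a : Fin m → ℂ) (f : ParamPoly n m) :
    specialize a f = map (eval a) (sumAlgEquiv ℂ (Fin n) (Fin m) f) := by
  have : (specialize a : ParamPoly n m →ₐ[ℂ] _) =
      (mapAlgHom (aeval a)).comp (sumAlgEquiv ℂ (Fin n) (Fin m)).toAlgHom := by
    ext i : 1
    rcases i with i | j <;> simp [specialize]
  rw [this]
  rfl

theorem specialize_surjective (a : Fin m → ℂ) :
    Function.Surjective (specialize a : ParamPoly n m →ₐ[ℂ] _) := fun f =>
  ⟨rename Sum.inl f, by
    rw [specialize, aeval_rename, Sum.elim_comp_inl, aeval_X_left_apply]⟩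

theorem coeff_coeff_sumAlgEquiv (f : ParamPoly n m) (e : Fin n →₀ ℕ) (d : Fin m →₀ ℕ) :
    coeff d (coeff e (sumAlgEquiv ℂ (Fin n) (Fin m) f)) = coeff (Finsupp.sumElim e d) f := by
  simp [sumAlgEquiv, coeff, AddMonoidAlgebra.curryAlgEquiv, AddMonoidAlgebra.curryRingEquiv,
    AddMonoidAlgebra.curryAddEquiv]

theorem degree_sumAlgEquiv (ox : MonomialOrder (Fin n)) (ot : MonomialOrder (Fin m))
    {f : ParamPoly n m} (hf : f ≠ 0) :
    ox.degree (sumAlgEquiv ℂ (Fin n) (Fin m) f) =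
      ((blockOrder ox ot).degree f).comapDomain Sum.inl Sum.inl_injective.injOn := by
  set s := (blockOrder ox ot).degree f with hs
  set e := s.comapDomain Sum.inl Sum.inl_injective.injOn with he
  set d := s.comapDomain Sum.inr Sum.inr_injective.injOn with hd
  have hsum : Finsupp.sumElim e d = s := Finsupp.comapDomain_sumElim_comapDomain s
  have hF : sumAlgEquiv ℂ (Fin n) (Fin m) f ≠ 0 := by simpa using hf
  refine ox.toSyn.injective (le_antisymm ?_ (ox.le_degree ?_))
  · obtain ⟨d', hd'⟩ := ne_zero_iff.1 (ox.coeff_degree_ne_zero_iff.2 hF)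
    rw [coeff_coeff_sumAlgEquiv] at hd'
    have hle := (blockOrder ox ot).le_degree (mem_support_iff.2 hd')
    rw [← hs, ← hsum] at hle
    by_contra hlt
    exact hle.not_gt ((blockOrder_lt_iff ox ot _ _ _ _).2 (Or.inl (not_le.1 hlt)))
  · refine mem_support_iff.2 (ne_zero_iff.2 ⟨d, ?_⟩)
    rw [coeff_coeff_sumAlgEquiv, hsum]
    exact (blockOrder ox ot).coeff_degree_ne_zero_iff.2 hf

theorem IsGroebnerBasis.exists_degree_le {σ : Type*} {ord : MonomialOrder σ}
    {G : Finset (MvPolynomial σ ℂ)} {I : Ideal (MvPolynomial σ ℂ)}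
    (hG : IsGroebnerBasis ord G I) {f : MvPolynomial σ ℂ} (hf : f ∈ I) (h0 : f ≠ 0) :
    ∃ g ∈ G, g ≠ 0 ∧ ord.degree g ≤ ord.degree f := by
  have hmem : ord.leadingTerm f ∈ Ideal.span (ord.leadingTerm '' (G : Set (MvPolynomial σ ℂ))) :=
    hG.2 ▸ Ideal.subset_span ⟨f, hf, rfl⟩
  rw [ord.span_leadingTerm_eq_span_monomial',
    ← Set.image_image (fun e => monomial e (1 : ℂ)) ord.degree,
    mem_ideal_span_monomial_image] at hmem
  obtain ⟨_, ⟨g, ⟨hg, hg0⟩, rfl⟩, hle⟩ := hmem (ord.degree f)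
    (by
      classical
      rw [MonomialOrder.leadingTerm, mem_support_iff, coeff_monomial, if_pos rfl]
      exact ord.leadingCoeff_ne_zero_iff.2 h0)
  exact ⟨g, hg, hg0, hle⟩

/-- Outside the bad set, the leading exponents of the specialized ideal are generated by the
leading exponents in `x` of the Gröbner basis; in particular they do not depend on `a`. -/
theorem leadingExponents_systemAt {P : Set (ParamPoly n m)}
    {ox : MonomialOrder (Fin n)} {ot : MonomialOrder (Fin m)} {G : Finset (ParamPoly n m)}
    (hG : IsGroebnerBasis (blockOrder ox ot) G (Ideal.span P)) {a : Fin m → ℂ}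
    (ha : a ∉ badSet G) :
    {e | ∃ f ∈ Ideal.span (systemAt P a), f ≠ 0 ∧ ox.degree f = e} =
      {e | ∃ g ∈ G, g ≠ 0 ∧ ox.degree (sumAlgEquiv ℂ (Fin n) (Fin m) g) ≤ e} := by
  set Φ := sumAlgEquiv ℂ (Fin n) (Fin m) with hΦ
  have hspan : Ideal.span (systemAt P a) = (Ideal.span P).map (specialize a) :=
    (Ideal.map_span _ _).symm
  have hlc : ∀ g ∈ G, g ≠ 0 → eval a (ox.leadingCoeff (Φ g)) ≠ 0 := by
    intro g hg hg0 h
    refine ha (Set.mem_biUnion (x := ox.leadingCoeff (Φ g)) ⟨?_, g, hg, _, rfl⟩ h)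
    exact ox.leadingCoeff_ne_zero_iff.2 (by simpa using hg0)
  ext e
  constructor
  · rintro ⟨f, hf, hf0, rfl⟩
    rw [hspan, Ideal.mem_map_iff_of_surjective _ (specialize_surjective a)] at hf
    obtain ⟨h, hh, rfl⟩ := hf
    rw [specialize_eq_map] at hf0 ⊢
    obtain ⟨_, ⟨g, ⟨hg, hg0⟩, rfl⟩, hle⟩ := ox.exists_degree_le_degree_map (eval a)
      ((Ideal.span P).comap Φ.symm) (Φ '' {g | g ∈ G ∧ g ≠ 0})
      (by rintro _ ⟨g, ⟨hg, -⟩, rfl⟩; simpa [Ideal.mem_comap] using hG.1 hg)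
      (by rintro _ ⟨g, ⟨hg, hg0⟩, rfl⟩; exact hlc g hg hg0)
      (by
        intro H hH hH0
        obtain ⟨h, rfl⟩ := Φ.surjective H
        have h0 : h ≠ 0 := by rintro rfl; simp at hH0
        obtain ⟨g, hg, hg0, hle⟩ := hG.exists_degree_le
          (by simpa [Ideal.mem_comap] using hH) h0
        refine ⟨Φ g, ⟨g, ⟨hg, hg0⟩, rfl⟩, ?_⟩
        rw [hΦ, degree_sumAlgEquiv ox ot hg0, degree_sumAlgEquiv ox ot h0]
        exact fun i => hle (Sum.inl i))
      (Φ h) (by simpa [Ideal.mem_comap] using hh) hf0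
    exact ⟨g, hg, hg0, hle⟩
  · rintro ⟨g, hg, hg0, hle⟩
    have hdeg := ox.degree_map_of_leadingCoeff_ne_zero (eval a) (hlc g hg hg0)
    have hne : map (eval a) (Φ g) ≠ 0 := fun h => hlc g hg hg0 <| by
      rw [MonomialOrder.leadingCoeff, ← coeff_map, h, coeff_zero]
    have hmon : monomial (e - ox.degree (Φ g)) (1 : ℂ) ≠ 0 := by simp
    refine ⟨monomial (e - ox.degree (Φ g)) 1 * map (eval a) (Φ g), ?_, mul_ne_zero hmon hne, ?_⟩
    · rw [hspan, ← specialize_eq_map]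
      exact Ideal.mul_mem_left _ _ (Ideal.mem_map_of_mem _ (hG.1 hg))
    · rw [ox.degree_mul hmon hne, hdeg]
      classical
      rw [ox.degree_monomial, if_neg one_ne_zero, tsub_add_cancel_of_le hle]

/-- The coordinate rings of the specialized systems outside the bad set have the same standard
monomials as a basis. -/
theorem nonempty_coordRing_linearEquiv {P : Set (ParamPoly n m)}
    {ox : MonomialOrder (Fin n)} {ot : MonomialOrder (Fin m)} {G : Finset (ParamPoly n m)}
    (hG : IsGroebnerBasis (blockOrder ox ot) G (Ideal.span P)) {a b : Fin m → ℂ}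
    (ha : a ∉ badSet G) (hb : b ∉ badSet G) :
    Nonempty (CoordRing (systemAt P a) ≃ₗ[ℂ] CoordRing (systemAt P b)) := by
  have hca := ox.isCompl_restrictSupport (Ideal.span (systemAt P a))
  have hcb := ox.isCompl_restrictSupport (Ideal.span (systemAt P b))
  rw [leadingExponents_systemAt hG ha] at hca
  rw [leadingExponents_systemAt hG hb] at hcb
  exact ⟨(Submodule.Quotient.restrictScalarsEquiv ℂ _).symm ≪≫ₗ
    Submodule.quotientEquivOfIsCompl _ _ hca ≪≫ₗ
    (Submodule.quotientEquivOfIsCompl _ _ hcb).symm ≪≫ₗ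
    Submodule.Quotient.restrictScalarsEquiv ℂ _⟩

end Specialization

/-! ### Counting solutions by the dimension of the coordinate ring -/

section Counting

variable {n : ℕ} (S : Set (MvPolynomial (Fin n) ℂ))

theorem evalAt_mk (p : zeroSet S) (f : MvPolynomial (Fin n) ℂ) :
    evalAt S p (Ideal.Quotient.mk _ f) = eval p.1 f := by
  simp [evalAt]

theorem pointIdeal_isMaximal (p : zeroSet S) : (pointIdeal S p).IsMaximal :=
  RingHom.ker_isMaximal_of_surjective _ fun c => ⟨algebraMap ℂ _ c, by simp⟩

theorem pointIdeal_injective : Function.Injective (pointIdeal S) := by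
  intro p q h
  ext i
  have hp : Ideal.Quotient.mk _ (X i - C (p.1 i)) ∈ pointIdeal S p := by
    rw [pointIdeal, RingHom.mem_ker, evalAt_mk]
    simp
  rw [h, pointIdeal, RingHom.mem_ker, evalAt_mk] at hp
  exact (sub_eq_zero.1 (by simpa using hp)).symm

/-- The Nullstellensatz for the coordinate ring: its maximal ideals belong to solutions. -/
theorem exists_pointIdeal_eq (M : Ideal (CoordRing S)) [hM : M.IsMaximal] :
    ∃ p : zeroSet S, pointIdeal S p = M := by
  have hM' : (M.comap (Ideal.Quotient.mk (Ideal.span S))).IsMaximal :=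
    Ideal.comap_isMaximal_of_surjective _ Ideal.Quotient.mk_surjective
  obtain ⟨x, hx⟩ := eq_vanishingIdeal_singleton_of_isMaximal ℂ hM'
  have hmem : ∀ f, Ideal.Quotient.mk (Ideal.span S) f ∈ M ↔ eval x f = 0 := fun f => by
    rw [← Ideal.mem_comap, hx, mem_vanishingIdeal_singleton_iff, aeval_eq_eval]
  refine ⟨⟨x, fun f hf => (hmem f).1 ?_⟩, ?_⟩
  · rw [Ideal.Quotient.eq_zero_iff_mem.2 (Ideal.subset_span hf)]
    exact M.zero_mem
  · ext r
    obtain ⟨f, rfl⟩ := Ideal.Quotient.mk_surjective r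
    rw [hmem, pointIdeal, RingHom.mem_ker, evalAt_mk]

theorem one_le_solutionMultiplicity (p : zeroSet S) : 1 ≤ solutionMultiplicity S p := by
  rw [solutionMultiplicity, Order.one_le_iff_ne_zero, Ne, Cardinal.toENat_eq_zero]
  exact (rank_pos (R := ℂ) (M := Localization.AtPrime (pointIdeal S p))).ne'

theorem finite_zeroSet_of_solutionCount_ne_top (h : solutionCount S ≠ ⊤) :
    Finite (zeroSet S) := by
  by_contra hfin
  rw [not_finite_iff_infinite] at hfin
  refine h (ENat.eq_top_iff_forall_ge.2 fun k => ?_)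
  obtain ⟨F, hF⟩ := Infinite.exists_subset_card_eq (zeroSet S) k
  calc (k : ℕ∞) = ∑ p ∈ F, 1 := by simp [hF]
    _ ≤ ∑ p ∈ F, solutionMultiplicity S p :=
        Finset.sum_le_sum fun p _ => one_le_solutionMultiplicity S p
    _ ≤ solutionCount S := le_iSup (fun F => ∑ p ∈ F, solutionMultiplicity S p) F

/-- A system with finitely many solutions has a finite-dimensional coordinate ring: the coordinate
ring is a Jacobson ring with finitely many maximal ideals, so its prime ideals are maximal. -/
theorem finite_coordRing_of_finite_zeroSet [Finite (zeroSet S)] :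
    Module.Finite ℂ (CoordRing S) := by
  have hclosed : (closedPoints (PrimeSpectrum (CoordRing S))).Finite := by
    refine (Set.finite_range fun p : zeroSet S =>
      (⟨pointIdeal S p, inferInstance⟩ : PrimeSpectrum (CoordRing S))).subset fun x hx => ?_
    have := (PrimeSpectrum.isClosed_singleton_iff_isMaximal x).1 (mem_closedPoints_iff.1 hx)
    obtain ⟨p, hp⟩ := exists_pointIdeal_eq S x.asIdeal
    exact ⟨p, PrimeSpectrum.ext hp⟩
  have := JacobsonSpace.discreteTopology hclosed
  rw [Module.finite_iff_krullDimLE_zero]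
  exact (PrimeSpectrum.discreteTopology_iff_finite_and_krullDimLE_zero.1 this).2

/-- The number of solutions counted with multiplicity is the dimension of the coordinate ring:
the latter is Artinian, hence the product of its localizations at the solutions. -/
theorem solutionCount_eq_finrank [Module.Finite ℂ (CoordRing S)] :
    solutionCount S = Module.finrank ℂ (CoordRing S) := by
  have : IsArtinianRing (CoordRing S) := (Module.finite_iff_isArtinianRing ℂ _).1 ‹_›
  have hbij : Function.Bijective fun p : zeroSet S =>
      (⟨pointIdeal S p, inferInstance⟩ : PrimeSpectrum (CoordRing S)) := by
    refine ⟨fun p q h => pointIdeal_injective S (congrArg PrimeSpectrum.asIdeal h), fun x => ?_⟩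
    obtain ⟨p, hp⟩ := exists_pointIdeal_eq S x.asIdeal
    exact ⟨p, PrimeSpectrum.ext hp⟩
  have := Fintype.ofFinite (PrimeSpectrum (CoordRing S))
  have : Fintype (zeroSet S) := Fintype.ofBijective _ (Equiv.ofBijective _ hbij).symm.bijective
  have hmult (p : zeroSet S) : solutionMultiplicity S p =
      Module.finrank ℂ (Localization.AtPrime (pointIdeal S p)) := by
    have : Module.Finite ℂ (Localization.AtPrime (pointIdeal S p)) :=
      Module.Finite.of_surjective
        (Algebra.algHom ℂ (CoordRing S) (Localization.AtPrime (pointIdeal S p))).toLinearMap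
        (IsArtinianRing.localization_surjective (pointIdeal S p).primeCompl _)
    rw [solutionMultiplicity, ← Module.finrank_eq_rank, Cardinal.toENat_nat]
  have hsup : solutionCount S = ∑ p, solutionMultiplicity S p :=
    le_antisymm (iSup_le fun F => Finset.sum_le_univ_sum_of_nonneg fun _ => zero_le)
      (le_iSup (fun F => ∑ p ∈ F, solutionMultiplicity S p) Finset.univ)
  rw [hsup, IsArtinianRing.finrank_eq_sum_primeSpectrum (CoordRing S) ℂ, Nat.cast_sum]
  exact Fintype.sum_bijective _ hbij _ _ hmult

theorem finite_coordRing_of_solutionCount_ne_top (h : solutionCount S ≠ ⊤) :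
    Module.Finite ℂ (CoordRing S) :=
  have := finite_zeroSet_of_solutionCount_ne_top S h
  finite_coordRing_of_finite_zeroSet S

end Counting

theorem mainTheorem3 (n m ℓ : ℕ) (P : Set (ParamPoly n m))
    (ox : MonomialOrder (Fin n)) (ot : MonomialOrder (Fin m))
    (G : Finset (ParamPoly n m))
    (hG : IsGroebnerBasis (blockOrder ox ot) G (Ideal.span P))
    (h₁ : ∃ E : Set (Fin m → ℂ), IsZariskiClosed E ∧ E ≠ Set.univ ∧
      ∀ a ∉ E, (ℓ : ℕ∞) ≤ solutionCount (systemAt P a))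
    (h₂ : ∃ a' ∉ badSet G, solutionCount (systemAt P a') = ℓ) :
    ∀ᵐ a : Fin m → ℂ, solutionCount (systemAt P a) = ℓ := by
  obtain ⟨a', ha', hcount⟩ := h₂
  have hfin' : Module.Finite ℂ (CoordRing (systemAt P a')) :=
    finite_coordRing_of_solutionCount_ne_top _ (by rw [hcount]; exact ENat.natCast_ne_top ℓ)
  have hbad : ∀ᵐ a : Fin m → ℂ, a ∉ badSet G := measure_eq_zero_iff_ae_notMem.1 (volume_badSet G)
  filter_upwards [hbad] with a ha
  obtain ⟨e⟩ := nonempty_coordRing_linearEquiv hG ha' ha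
  have : Module.Finite ℂ (CoordRing (systemAt P a)) := Module.Finite.equiv e
  rw [solutionCount_eq_finrank, ← e.finrank_eq, ← solutionCount_eq_finrank, hcount]
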